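/- Let $\overline{\mathbb N}=\{0,1,2,\dots\}\cup\{\infty\}$, let $X$ be a topological space and $w:X\to\overline{\mathbb N}$ a function. The order $o_w(x)$ of a point $x\in X$ is the least ordinal $\alpha$ for which there are a neighbourhood $U$ of $x$ and $n<\omega$ such that every $y\in U$ satisfies $o_w(y)<\alpha$ or $w(y)\le n$ (recursion on $\alpha$), and $o_w(x)=\infty$ if there is no such $\alpha$; in particular $o_w(x)=0$ if and only if $w$ is bounded by a natural number near $x$, and $o_w(x)=\infty$ if $w(x)=\infty$. The rank of $x$ is $r_w(x)=\omega\cdot o_w(x)+w(x)$ (and $\infty$ if $o_w(x)=\infty$), and the rank of $w$ is $r(w)=\sup_{x\in X}r_w(x)$. Let $A$ be a separable C*-algebra, and let $X=\mathrm{Prim}(A)$ be the space of kernels of (nonzero) irreducible representations of $A$ with the Jacobson topology, whose closed sets are the sets $\{t\in X: I\subseteq t\}$ for closed two-sided ideals $I$ of $A$. For $b\in A$ let $w_b:X\to\overline{\mathbb N}$, $\mathrm{Ker}(\rho)\mapsto\mathrm{rank}(\rho(b))$. A local section is a pair $(b,U)$ of $b\in A$ and an open set $U\subseteq X$ such that $\rho(b)\neq0$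 whenever $\mathrm{Ker}(\rho)\in U$; it is around an irreducible representation $\pi$ if $\mathrm{Ker}(\pi)\in U$. Its Fell rank is the rank of the function $w_b|_U$ on the space $U$. The Fell rank of an irreducible representation $\pi$ is the least of the Fell ranks of the local sections around $\pi$, and the Fell rank of $A$ is the supremum of the Fell ranks of its irreducible representations. The Pedersen rank of $a\in A$ is $r(w_a)$. For a countable ordinal $\alpha$, let $\Pi_\alpha(A)$ be the closed two-sided ideal of $A$ generated by the elements of Pedersen rank at most $\alpha$; $A$ is type $I_\alpha$ if $A=\Pi_{1+\alpha}(A)$. **Theorem.** Let $A$ be a separable C*-algebra and let $\alpha$ be a countable ordinal. Then $A$ is type $I_\alpha$ if and only if the Fell rank of $A$ is at most $1+\alpha$. -/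

import Mathlib

open Topology TopologicalSpace Set

universe u

noncomputable section

/-! ### Order and rank of a function with values in `ℕ ∪ {∞}` -/

section Weight

variable {X : Type u} [TopologicalSpace X]

/-- The set `X_α = {x | o_w(x) ≤ α}` of points of order at most `α`, by recursion on `α`: near `x`,
the function `w` is bounded by a natural number at all points whose order is not smaller
than `α`. For `α = 0` this says that `w` is bounded near `x`. -/
def weightLevel (w : X → ℕ∞) (α : Ordinal.{u}) : Set X :=
  {x | ∃ n : ℕ, ∀ᶠ y in 𝓝 x, w y ≤ (n : ℕ∞) ∨ ∃ β, ∃ _ : β < α, y ∈ weightLevel w β}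
termination_by α

/-- The order `o_w(x)`, an ordinal or `∞ = ⊤`. -/
def weightOrder (w : X → ℕ∞) (x : X) : WithTop Ordinal.{u} :=
  sInf {a | ∃ α : Ordinal.{u}, x ∈ weightLevel w α ∧ a = (α : WithTop Ordinal.{u})}

/-- The rank `r_w(x) = ω * o_w(x) + w(x)`, which is `∞` if `o_w(x) = ∞`. (Where `o_w(x)` is an
ordinal, the value `w(x)` is finite, see `weightOrder_eq_top`.) -/
def weightRankAt (w : X → ℕ∞) (x : X) : WithTop Ordinal.{u} :=
  (weightOrder w x).map fun α => Ordinal.omega0 * α + ((w x).toNat : Ordinal.{u})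

/-- The rank `r(w)`, the supremum of the ranks of the points. -/
def weightRank (w : X → ℕ∞) : WithTop Ordinal.{u} :=
  ⨆ x : X, weightRankAt w x

theorem mem_weightLevel {w : X → ℕ∞} {α : Ordinal.{u}} {x : X} :
    x ∈ weightLevel w α ↔
      ∃ n : ℕ, ∀ᶠ y in 𝓝 x, w y ≤ (n : ℕ∞) ∨ ∃ β < α, y ∈ weightLevel w β := by
  rw [weightLevel]
  simp

theorem weightLevel_mono (w : X → ℕ∞) {α β : Ordinal.{u}} (h : α ≤ β) :
    weightLevel w α ⊆ weightLevel w β := by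
  intro x hx
  rw [mem_weightLevel] at hx ⊢
  obtain ⟨n, hn⟩ := hx
  refine ⟨n, hn.mono fun y hy => hy.imp id ?_⟩
  rintro ⟨γ, hγ, hy⟩
  exact ⟨γ, hγ.trans_le h, hy⟩

theorem weightOrder_le_iff {w : X → ℕ∞} {α : Ordinal.{u}} {x : X} :
    weightOrder w x ≤ α ↔ x ∈ weightLevel w α := by
  constructor
  · intro h
    have hne : {a | ∃ α : Ordinal.{u}, x ∈ weightLevel w α ∧
        a = (α : WithTop Ordinal.{u})}.Nonempty := by
      by_contra hne
      rw [Set.not_nonempty_iff_eq_empty] at hne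
      rw [weightOrder, hne, sInf_empty] at h
      exact absurd h (by simp)
    obtain ⟨β, hβ, e⟩ := csInf_mem hne
    rw [weightOrder, e, WithTop.coe_le_coe] at h
    exact weightLevel_mono w h hβ
  · intro h
    exact sInf_le ⟨α, h, rfl⟩

/-- Sanity check: the order is `∞` where `w` is `∞`. -/
theorem weightOrder_eq_top {w : X → ℕ∞} {x : X} (h : w x = ⊤) : weightOrder w x = ⊤ := by
  have key : ∀ α : Ordinal.{u}, x ∉ weightLevel w α := by
    intro α
    induction α using WellFoundedLT.induction with
    | ind α ih =>
      intro hx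
      obtain ⟨n, hn⟩ := mem_weightLevel.1 hx
      rcases hn.self_of_nhds with h1 | ⟨β, hβ, h2⟩
      · rw [h] at h1
        exact absurd h1 (by simp)
      · exact ih β hβ h2
  by_contra hne
  obtain ⟨α, hα⟩ := WithTop.ne_top_iff_exists.1 hne
  exact key α (weightOrder_le_iff.1 hα.ge)

/-- Sanity check: the order is `0` exactly where `w` is locally bounded. -/
theorem weightOrder_eq_zero_iff {w : X → ℕ∞} {x : X} :
    weightOrder w x = ((0 : Ordinal.{u}) : WithTop Ordinal.{u}) ↔
      ∃ n : ℕ, ∃ U ∈ 𝓝 x, ∀ y ∈ U, w y ≤ (n : ℕ∞) := by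
  have h0 : (∃ n : ℕ, ∃ U ∈ 𝓝 x, ∀ y ∈ U, w y ≤ (n : ℕ∞)) ↔
      x ∈ weightLevel w (0 : Ordinal.{u}) := by
    rw [mem_weightLevel]
    refine exists_congr fun n => ?_
    rw [Filter.eventually_iff_exists_mem]
    simp
  rw [h0, ← weightOrder_le_iff]
  refine ⟨fun h => h.le, fun h => le_antisymm h ?_⟩
  exact bot_le

/-- Sanity check: `o_w(x) = α` if `w(x)` is finite, all points near `x` but different from it have
order less than `α`, and their ranks come above each `β < ω * α` arbitrarily near `x`. -/
theorem weightOrder_eq_of_punctured {w : X → ℕ∞} {x : X} {α : Ordinal.{u}} (hx : w x ≠ ⊤)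
    (h1 : ∃ U ∈ 𝓝 x, ∀ y ∈ U, y ≠ x → weightOrder w y < α)
    (h2 : ∀ β < Ordinal.omega0 * α, ∀ W ∈ 𝓝 x, ∃ y ∈ W, y ≠ x ∧
      (β : WithTop Ordinal.{u}) < weightRankAt w y) :
    weightOrder w x = α := by
  apply le_antisymm
  · rw [weightOrder_le_iff, mem_weightLevel]
    obtain ⟨U, hU, h⟩ := h1
    refine ⟨(w x).toNat, Filter.mem_of_superset hU fun y hy => ?_⟩
    by_cases e : y = x
    · left
      rw [e, ENat.natCast_toNat hx]
    · right
      have := h y hy e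
      obtain ⟨β, hβ⟩ := WithTop.ne_top_iff_exists.1 this.ne_top
      rw [← hβ, WithTop.coe_lt_coe] at this
      exact ⟨β, this, weightOrder_le_iff.1 hβ.ge⟩
  · by_contra hlt
    rw [not_le] at hlt
    obtain ⟨γ, hγ⟩ := WithTop.ne_top_iff_exists.1 hlt.ne_top
    rw [← hγ, WithTop.coe_lt_coe] at hlt
    have hxγ := weightOrder_le_iff.1 hγ.ge
    obtain ⟨n, hn⟩ := mem_weightLevel.1 hxγ
    have hb : Ordinal.omega0 * γ + (n : Ordinal.{u}) < Ordinal.omega0 * α := by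
      calc Ordinal.omega0 * γ + (n : Ordinal.{u}) < Ordinal.omega0 * γ + Ordinal.omega0 := by
            gcongr
            exact Ordinal.natCast_lt_omega0 n
        _ = Ordinal.omega0 * (Order.succ γ) := (Ordinal.mul_succ _ _).symm
        _ ≤ Ordinal.omega0 * α := by
            gcongr
            exact Order.succ_le_of_lt hlt
    obtain ⟨y, ⟨hy1, hy2⟩, -, hy3⟩ := h2 _ hb _ (hn.and hn.eventually_nhds)
    have hyγ : weightOrder w y ≤ γ := weightOrder_le_iff.2 (mem_weightLevel.2 ⟨n, hy2⟩)
    obtain ⟨δ, hδ⟩ := WithTop.ne_top_iff_exists.1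
      (lt_of_le_of_lt hyγ (WithTop.coe_lt_top γ)).ne
    have hδγ : δ ≤ γ := by rwa [← hδ, WithTop.coe_le_coe] at hyγ
    rw [weightRankAt, ← hδ, WithTop.map_coe, WithTop.coe_lt_coe] at hy3
    refine absurd hy3 (not_lt.2 ?_)
    rcases hy1 with hw | ⟨β, hβ, hyβ⟩
    · have : (w y).toNat ≤ n := ENat.toNat_le_of_le_natCast hw
      have h3 : ((w y).toNat : Ordinal.{u}) ≤ (n : Ordinal.{u}) := by exact_mod_cast this
      gcongr
    · have hδβ : δ ≤ β := by
        have := weightOrder_le_iff.2 hyβ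
        rwa [← hδ, WithTop.coe_le_coe] at this
      calc Ordinal.omega0 * δ + ((w y).toNat : Ordinal.{u})
          ≤ Ordinal.omega0 * δ + Ordinal.omega0 := by
            gcongr
            exact (Ordinal.natCast_lt_omega0 _).le
        _ = Ordinal.omega0 * (Order.succ δ) := (Ordinal.mul_succ _ _).symm
        _ ≤ Ordinal.omega0 * γ := by
            gcongr
            exact Order.succ_le_of_lt (hδβ.trans_lt hβ)
        _ ≤ Ordinal.omega0 * γ + (n : Ordinal.{u}) := le_self_add

end Weight

/-! ### Irreducible representations and the primitive spectrum -/

/-- A (topologically) irreducible representation of the C*-algebra `A` on a Hilbert space: a nonzero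
*-homomorphism to the bounded operators without nontrivial closed invariant subspaces. Since it
is cyclic, the universe of `A` has enough Hilbert spaces. -/
structure IrrRep (A : Type u) [NonUnitalCStarAlgebra A] where
  H : Type u
  [normedAddCommGroup : NormedAddCommGroup H]
  [innerProductSpace : InnerProductSpace ℂ H]
  [completeSpace : CompleteSpace H]
  toHom : A →⋆ₙₐ[ℂ] (H →L[ℂ] H)
  ne_zero : ∃ a, toHom a ≠ 0
  irreducible : ∀ M : Submodule ℂ H, IsClosed (M : Set H) →
    (∀ a, ∀ ξ ∈ M, toHom a ξ ∈ M) → M = ⊥ ∨ M = ⊤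

attribute [instance] IrrRep.normedAddCommGroup IrrRep.innerProductSpace IrrRep.completeSpace

section CStar

variable {A : Type u} [NonUnitalCStarAlgebra A]

/-- The kernel of an irreducible representation. -/
def IrrRep.ker (ρ : IrrRep A) : TwoSidedIdeal A := TwoSidedIdeal.ker ρ.toHom

theorem IrrRep.mem_ker {ρ : IrrRep A} {a : A} : a ∈ ρ.ker ↔ ρ.toHom a = 0 :=
  TwoSidedIdeal.mem_ker _

/-- The rank of the operator `ρ(b)`, in `ℕ ∪ {∞}`. -/
def IrrRep.rank (ρ : IrrRep A) (b : A) : ℕ∞ :=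
  Cardinal.toENat (LinearMap.rank (ρ.toHom b : ρ.H →ₗ[ℂ] ρ.H))

/-- The kernels of irreducible representations are prime. -/
theorem IrrRep.ker_prime (ρ : IrrRep A) {I J : TwoSidedIdeal A} (h : I ⊓ J ≤ ρ.ker) :
    I ≤ ρ.ker ∨ J ≤ ρ.ker := by
  by_contra! hc
  obtain ⟨hI, hJ⟩ := hc
  obtain ⟨i, hi, hi'⟩ := SetLike.not_le_iff_exists.1 hI
  obtain ⟨j, hj, hj'⟩ := SetLike.not_le_iff_exists.1 hJ
  rw [IrrRep.mem_ker] at hi' hj'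
  have key : ∀ a : A, ρ.toHom j ∘L ρ.toHom a ∘L ρ.toHom i = 0 := by
    intro a
    have : j * (a * i) ∈ ρ.ker :=
      h ⟨I.mul_mem_left _ _ (I.mul_mem_left _ _ hi), J.mul_mem_right _ _ hj⟩
    rw [IrrRep.mem_ker, map_mul, map_mul] at this
    exact this
  -- the closed invariant subspace of the vectors that `π(j)π(a)` kills for all `a`
  let M : Submodule ℂ ρ.H := ⨅ a : A, LinearMap.ker (ρ.toHom j ∘L ρ.toHom a).toLinearMap
  have hM : ∀ ξ, ξ ∈ M ↔ ∀ a, ρ.toHom j (ρ.toHom a ξ) = 0 := by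
    intro ξ
    simp [M, Submodule.mem_iInf]
  have hclosed : IsClosed (M : Set ρ.H) := by
    have : (M : Set ρ.H) = ⋂ a, {ξ | ρ.toHom j (ρ.toHom a ξ) = 0} := by
      ext ξ
      simp [hM]
    rw [this]
    exact isClosed_iInter fun a => isClosed_eq (by fun_prop) continuous_const
  have hinv : ∀ a, ∀ ξ ∈ M, ρ.toHom a ξ ∈ M := by
    intro a ξ hξ
    rw [hM] at hξ ⊢
    intro c
    have := hξ (c * a)
    rwa [map_mul] at this
  rcases ρ.irreducible M hclosed hinv with hb | ht
  · apply hi'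
    ext ξ
    have : ρ.toHom i ξ ∈ M := by
      rw [hM]
      intro a
      exact DFunLike.congr_fun (key a) ξ
    rw [hb] at this
    simpa using this
  · -- now `π(j)π(A) = 0`, so that `π(j)π(j)⋆ = 0`
    apply hj'
    have h0 : ρ.toHom j * star (ρ.toHom j) = 0 := by
      rw [← map_star]
      ext ξ
      have : ξ ∈ M := by rw [ht]; trivial
      exact (hM ξ).1 this (star j)
    exact CStarRing.mul_star_self_eq_zero_iff _ |>.1 h0

variable (A) in
/-- The primitive spectrum: the kernels of the irreducible representations. -/
def PrimitiveSpectrum : Type u := {P : TwoSidedIdeal A // ∃ ρ : IrrRep A, ρ.ker = P}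

/-- The kernel of an irreducible representation as a point of the primitive spectrum. -/
def IrrRep.point (ρ : IrrRep A) : PrimitiveSpectrum A := ⟨ρ.ker, ρ, rfl⟩

/-- The primitive ideals that contain `I`. -/
def hull (I : TwoSidedIdeal A) : Set (PrimitiveSpectrum A) := {t | I ≤ t.1}

/-- The least closed two-sided ideal that contains `S`. (A closed two-sided ideal of the ring `A` is a
complex subspace, because `A` has approximate units.) -/
def closedIdealSpan (S : Set A) : TwoSidedIdeal A :=
  sInf {I | IsClosed (I : Set A) ∧ S ⊆ I}

theorem subset_closedIdealSpan (S : Set A) : S ⊆ closedIdealSpan S := by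
  intro a ha
  rw [SetLike.mem_coe, closedIdealSpan, TwoSidedIdeal.mem_sInf]
  exact fun I hI => hI.2 ha

theorem isClosed_closedIdealSpan (S : Set A) : IsClosed (closedIdealSpan S : Set A) := by
  have : (closedIdealSpan S : Set A) =
      ⋂ I ∈ {I : TwoSidedIdeal A | IsClosed (I : Set A) ∧ S ⊆ I}, (I : Set A) := by
    ext a
    rw [SetLike.mem_coe, closedIdealSpan, TwoSidedIdeal.mem_sInf]
    simp
  rw [this]
  exact isClosed_biInter fun I hI => hI.1

theorem closedIdealSpan_le {S : Set A} {I : TwoSidedIdeal A} (hI : IsClosed (I : Set A))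
    (h : S ⊆ I) : closedIdealSpan S ≤ I := sInf_le ⟨hI, h⟩

theorem PrimitiveSpectrum.isClosed (t : PrimitiveSpectrum A) : IsClosed (t.1 : Set A) := by
  obtain ⟨P, ρ, rfl⟩ := t
  have hc : Continuous ρ.toHom :=
    AddMonoidHomClass.continuous_of_bound ρ.toHom 1 fun a => by
      simpa using NonUnitalStarAlgHom.norm_apply_le ρ.toHom a
  have : ((ρ.ker : TwoSidedIdeal A) : Set A) = {a | ρ.toHom a = 0} := by
    ext a
    exact IrrRep.mem_ker
  change IsClosed ((ρ.ker : TwoSidedIdeal A) : Set A)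
  rw [this]
  exact isClosed_eq hc continuous_const

/-- The Jacobson topology: the closed sets are the hulls of the closed two-sided ideals. -/
instance : TopologicalSpace (PrimitiveSpectrum A) where
  IsOpen U := ∃ I : TwoSidedIdeal A, IsClosed (I : Set A) ∧ U = (hull I)ᶜ
  isOpen_univ := ⟨⊤, by simp, by
    ext t
    obtain ⟨P, ρ, rfl⟩ := t
    obtain ⟨a, ha⟩ := ρ.ne_zero
    have : ¬ (⊤ : TwoSidedIdeal A) ≤ ρ.ker := fun h =>
      ha (IrrRep.mem_ker.1 (h (by trivial)))
    exact ⟨fun _ => this, fun _ => trivial⟩⟩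
  isOpen_inter := by
    rintro U V ⟨I, hI, rfl⟩ ⟨J, hJ, rfl⟩
    refine ⟨I ⊓ J, ?_, ?_⟩
    · have : ((I ⊓ J : TwoSidedIdeal A) : Set A) = (I : Set A) ∩ J := by
        ext a
        exact TwoSidedIdeal.mem_inf A
      rw [this]
      exact hI.inter hJ
    · rw [← Set.compl_union]
      congr 1
      ext t
      obtain ⟨P, ρ, rfl⟩ := t
      constructor
      · rintro (h | h)
        · exact (inf_le_left : I ⊓ J ≤ I).trans h
        · exact (inf_le_right : I ⊓ J ≤ J).trans h
      · intro h
        exact ρ.ker_prime h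
  isOpen_sUnion := by
    intro 𝒰 h𝒰
    refine ⟨closedIdealSpan
      (⋃₀ {S | ∃ I : TwoSidedIdeal A, (hull I)ᶜ ∈ 𝒰 ∧ S = (I : Set A)}),
      isClosed_closedIdealSpan _, ?_⟩
    ext t
    rw [Set.mem_sUnion, Set.mem_compl_iff]
    constructor
    · rintro ⟨U, hU, ht⟩ hc
      obtain ⟨I, -, rfl⟩ := h𝒰 U hU
      exact ht fun a ha => hc (subset_closedIdealSpan _ ⟨I, ⟨I, hU, rfl⟩, ha⟩)
    · intro hc
      by_contra! hne
      refine hc (closedIdealSpan_le t.isClosed ?_)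
      rintro a ⟨S, ⟨I, hI, rfl⟩, ha⟩
      have := hne _ hI
      rw [Set.mem_compl_iff, not_not] at this
      exact this ha

/-! ### Fell rank, Pedersen rank, and type `I_α` -/

/-- The function `w_b : Ker(ρ) ↦ rank(ρ(b))` on the primitive spectrum. The rank of `ρ(b)` depends
only on the kernel of `ρ`, since irreducible representations with the same kernel are equivalent
if a nonzero operator of finite rank is in the image of one of them; so the infimum is over
equal numbers. -/
def pedersenFunction (b : A) (t : PrimitiveSpectrum A) : ℕ∞ :=
  ⨅ ρ : {ρ : IrrRep A // ρ.point = t}, ρ.1.rank b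

variable (A) in
/-- A local section: an element `b` and an open set `U` of the primitive spectrum such that
`ρ(b) ≠ 0` if `Ker(ρ) ∈ U`. -/
structure LocalSection where
  b : A
  U : Opens (PrimitiveSpectrum A)
  nonvanishing : ∀ ρ : IrrRep A, ρ.point ∈ U → ρ.toHom b ≠ 0

/-- The Fell rank of `(b, U)`, the rank of the restriction of `w_b` to `U`. -/
def LocalSection.fellRank (s : LocalSection A) : WithTop Ordinal.{u} :=
  weightRank fun t : s.U => pedersenFunction s.b (t : PrimitiveSpectrum A)

/-- The Fell rank of an irreducible representation, the least of the Fell ranks of the local sections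
around it. -/
def IrrRep.fellRank (π : IrrRep A) : WithTop Ordinal.{u} :=
  sInf {r | ∃ s : LocalSection A, π.point ∈ s.U ∧ r = s.fellRank}

variable (A) in
/-- The Fell rank of a C*-algebra. -/
def fellRank : WithTop Ordinal.{u} := ⨆ π : IrrRep A, π.fellRank

/-- The Pedersen rank of an element. -/
def pedersenRank (a : A) : WithTop Ordinal.{u} := weightRank (pedersenFunction a)

variable (A) in
/-- The Fell ideal of rank `α`, the closed ideal generated by the elements of Pedersen rank at
most `α`. -/
def fellIdeal (α : Ordinal.{u}) : TwoSidedIdeal A :=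
  closedIdealSpan {a | pedersenRank a ≤ (α : WithTop Ordinal.{u})}

variable (A) in
/-- The C*-algebra `A` is type `I_α`. -/
def IsTypeI (α : Ordinal.{u}) : Prop := fellIdeal A (1 + α) = ⊤

end CStar

end

/-!
The rank of a weight `w` is at most `ω * γ + n` if and only if `w x ≤ n` at all points `x` whose
order is not smaller than `γ` (`weightRank_le_iff`). Hence the bound passes to restrictions to
open subspaces, and also to extensions by zero from open subspaces, since nothing is required of a
point of weight `0`, wherever it lies (`weightRank_le_of_isOpenEmbedding`).

Consequently an irreducible representation `π` has Fell rank at most `β` if and only if `π(a) ≠ 0`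
for some `a` of Pedersen rank at most `β`. Such an element is a local section on the open set
where it does not vanish. Conversely, let `(b, U)` be a local section around `π`, and let the
closed ideal `J` define `U`. As `π` is irreducible, `π(j x b) ≠ 0` for some `j ∈ J` and `x ∈ A`,
and the rank function of `j x b` is at most that of `b` on `U` and vanishes off `U`.

So the Fell rank of `A` is at most `β` if and only if no kernel of an irreducible representation
contains the Fell ideal of rank `β`, which means that the Fell ideal is all of `A`, because every
proper closed ideal is in the kernel of an irreducible representation (`exists_irrRep_le_ker`).
For an ideal `J` and an element `a ∉ J` of a unital C*-algebra, the Hahn–Banach theorem gives a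
state that vanishes on `J` but not at `a⋆a`, the Krein–Milman theorem makes it pure, and the GNS
representation of a pure state is irreducible. For nonunital `A` this is applied in the
unitization.
-/

noncomputable section

/-! ### Functionals that vanish on an ideal -/

section States

open scoped ComplexOrder

variable {B : Type u} [CStarAlgebra B] [PartialOrder B] [StarOrderedRing B]

/-- A two-sided ideal contains an approximate right unit for each of its elements: the element
`1 - q` is `j⋆j (δ + j⋆j)⁻¹` for a small number `δ`, and `‖j q‖² = ‖q j⋆j q‖ ≤ δ`. -/
theorem exists_isSelfAdjoint_norm_mul_lt {J : Submodule ℂ B} (hl : ∀ b, ∀ j ∈ J, b * j ∈ J)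
    (hr : ∀ b, ∀ j ∈ J, j * b ∈ J) {j : B} (hj : j ∈ J) {ε : ℝ} (hε : 0 < ε) :
    ∃ q : B, IsSelfAdjoint q ∧ ‖q‖ ≤ 1 ∧ 1 - q ∈ J ∧ ‖j * q‖ < ε := by
  obtain ⟨δ, hδ, hδε⟩ : ∃ δ : ℝ, 0 < δ ∧ δ < ε ^ 2 := exists_between (by positivity)
  set c : B := star j * j with hc
  have hc0 : 0 ≤ c := star_mul_self_nonneg j
  have hspec : ∀ x ∈ spectrum ℝ c, 0 < δ + x := fun x hx => by
    have := spectrum_nonneg_of_nonneg hc0 hx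
    positivity
  have hcont : ContinuousOn (fun x : ℝ => (δ + x)⁻¹) (spectrum ℝ c) :=
    ContinuousOn.inv₀ (by fun_prop) fun x hx => (hspec x hx).ne'
  have hcontq : ContinuousOn (fun x : ℝ => δ * (δ + x)⁻¹) (spectrum ℝ c) :=
    continuousOn_const.mul hcont
  let q : B := cfc (fun x : ℝ => δ * (δ + x)⁻¹) c
  have hq : IsSelfAdjoint q := cfc_predicate _ c
  have hq' : ‖q‖ ≤ 1 := by
    refine norm_cfc_le zero_le_one fun x hx => ?_
    have h1 := hspec x hx
    have h2 := spectrum_nonneg_of_nonneg hc0 hx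
    rw [Real.norm_of_nonneg (by positivity), ← div_eq_mul_inv, div_le_one h1]
    linarith
  refine ⟨q, hq, hq', ?_, ?_⟩
  · have h1 : 1 - q = c * cfc (fun x : ℝ => (δ + x)⁻¹) c := by
      have e1 : c * cfc (fun x : ℝ => (δ + x)⁻¹) c = cfc (fun x : ℝ => x * (δ + x)⁻¹) c := by
        rw [cfc_mul (fun x : ℝ => x) _ c continuousOn_id hcont, cfc_id' ℝ c]
      have e2 : 1 - q = cfc (fun x : ℝ => 1 - δ * (δ + x)⁻¹) c := by
        rw [cfc_sub (fun _ : ℝ => (1 : ℝ)) _ c continuousOn_const hcontq, cfc_const_one ℝ c]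
      rw [e1, e2]
      refine cfc_congr fun x hx => ?_
      have := (hspec x hx).ne'
      field_simp
      ring
    rw [h1]
    exact hr _ _ (hl _ _ hj)
  · have h1 : star (j * q) * (j * q) =
        cfc (fun x : ℝ => δ * (δ + x)⁻¹ * x * (δ * (δ + x)⁻¹)) c := by
      rw [cfc_mul (fun x : ℝ => δ * (δ + x)⁻¹ * x) _ c (hcontq.mul continuousOn_id) hcontq,
        cfc_mul _ (fun x : ℝ => x) c hcontq continuousOn_id, cfc_id' ℝ c, star_mul, hq.star_eq]
      simp only [q, hc, mul_assoc]
    have h2 : ‖j * q‖ * ‖j * q‖ ≤ δ := by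
      rw [← CStarRing.norm_star_mul_self, h1]
      refine norm_cfc_le hδ.le fun x hx => ?_
      have h3 := hspec x hx
      have h4 := spectrum_nonneg_of_nonneg hc0 hx
      rw [Real.norm_of_nonneg (by positivity)]
      have h5 : δ * (δ + x)⁻¹ ≤ 1 := by
        rw [← div_eq_mul_inv, div_le_one h3]
        linarith
      have h6 : (δ + x)⁻¹ * x ≤ 1 := by
        rw [mul_comm, ← div_eq_mul_inv, div_le_one h3]
        linarith
      calc δ * (δ + x)⁻¹ * x * (δ * (δ + x)⁻¹)
          = δ * (((δ + x)⁻¹ * x) * (δ * (δ + x)⁻¹)) := by ring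
        _ ≤ δ * (1 * 1) := by gcongr
        _ = δ := by ring
    nlinarith [norm_nonneg (j * q)]

/-- Modulo a two-sided ideal `J`, a positive perturbation does not bring `a⋆a` closer to `0`: the
distance of `a⋆a + p` to `J + iB_sa` is at least `r²` if that of `a` to `J` is at least `r`. -/
theorem sq_le_norm_star_mul_self_add {J : Submodule ℂ B} (hl : ∀ b, ∀ j ∈ J, b * j ∈ J)
    (hr : ∀ b, ∀ j ∈ J, j * b ∈ J) {a : B} {r : ℝ} (hr0 : 0 ≤ r) (ha : ∀ j ∈ J, r ≤ ‖a - j‖)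
    {p j k : B} (hp : 0 ≤ p) (hj : j ∈ J) (hk : IsSelfAdjoint k) :
    r ^ 2 ≤ ‖star a * a + (p + j + Complex.I • k)‖ := by
  refine le_of_forall_pos_le_add fun ε hε => ?_
  obtain ⟨q, hq, hq1, hqJ, hjq⟩ := exists_isSelfAdjoint_norm_mul_lt hl hr hj hε
  set N := ‖star a * a + (p + j + Complex.I • k)‖
  have hconj : ∀ x : B, ‖q * x * q‖ ≤ ‖x‖ := fun x => by
    calc ‖q * x * q‖ ≤ ‖q‖ * ‖x‖ * ‖q‖ := norm_mul₃_le
      _ ≤ 1 * ‖x‖ * 1 := by gcongr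
      _ = ‖x‖ := by ring
  have hsa : IsSelfAdjoint (q * (star a * a + p) * q) := by
    have h : IsSelfAdjoint (star a * a + p) := (IsSelfAdjoint.star_mul_self a).add (.of_nonneg hp)
    have := h.conjugate q
    rwa [hq.star_eq] at this
  have hsk : IsSelfAdjoint (q * k * q) := by
    have := hk.conjugate q
    rwa [hq.star_eq] at this
  -- the compression by `q` removes `j` up to `ε`, and the real part of the rest is positive
  have h1 : ‖q * (star a * a + p) * q + Complex.I • (q * k * q)‖ ≤ N + ε := by
    have e : q * (star a * a + p) * q + Complex.I • (q * k * q) =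
        q * (star a * a + (p + j + Complex.I • k)) * q - q * (j * q) := by
      simp only [mul_add, add_mul, mul_smul_comm, smul_mul_assoc, mul_assoc]
      abel
    rw [e]
    refine (norm_sub_le _ _).trans (add_le_add (hconj _) ?_)
    calc ‖q * (j * q)‖ ≤ ‖q‖ * ‖j * q‖ := norm_mul_le _ _
      _ ≤ 1 * ε := by gcongr
      _ = ε := one_mul _
  have h2 : ‖q * (star a * a + p) * q‖ ≤ N + ε := by
    refine le_trans ?_ h1
    have := realPart.norm_le (q * (star a * a + p) * q + Complex.I • (q * k * q))
    rw [map_add, realPart_I_smul, hsk.imaginaryPart, neg_zero, add_zero] at this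
    rwa [AddSubgroup.coe_norm, hsa.coe_realPart] at this
  have h3 : ‖a * q‖ * ‖a * q‖ ≤ N + ε := by
    rw [← CStarRing.norm_star_mul_self]
    refine le_trans (CStarAlgebra.norm_le_norm_of_nonneg_of_le (star_mul_self_nonneg _) ?_) h2
    rw [star_mul, hq.star_eq]
    have : 0 ≤ q * p * q := by
      have := star_left_conjugate_nonneg hp q
      rwa [hq.star_eq] at this
    calc q * star a * (a * q) ≤ q * star a * (a * q) + q * p * q := le_add_of_nonneg_right this
      _ = q * (star a * a + p) * q := by simp only [mul_add, add_mul, mul_assoc]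
  have h4 : r ≤ ‖a * q‖ := by
    have := ha _ (hl a _ hqJ)
    rwa [mul_sub, mul_one, sub_sub_cancel] at this
  nlinarith

/-- A positive functional that vanishes on a closed ideal, but not at a given element `a⋆a`
outside of it, exists by the Hahn–Banach theorem, as `-a⋆a` has positive distance to the cone
`B₊ + J + iB_sa`. -/
theorem exists_positive_vanishing {J : Submodule ℂ B} (hJ : IsClosed (J : Set B))
    (hl : ∀ b, ∀ j ∈ J, b * j ∈ J) (hr : ∀ b, ∀ j ∈ J, j * b ∈ J) {a : B} (ha : a ∉ J) :
    ∃ f : B →ₚ[ℂ] ℂ, (∀ j ∈ J, f j = 0) ∧ 0 < (f (star a * a)).re := by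
  obtain ⟨r, hr0, hball⟩ := Metric.isOpen_iff.1 hJ.isOpen_compl a ha
  have hdist : ∀ j ∈ J, r ≤ ‖a - j‖ := fun j hj => by
    by_contra! h
    refine hball (?_ : j ∈ _) hj
    rwa [Metric.mem_ball, dist_eq_norm, norm_sub_rev]
  let C : Set B := {x | ∃ p j k : B, 0 ≤ p ∧ j ∈ J ∧ IsSelfAdjoint k ∧ x = p + j + Complex.I • k}
  have hC : Convex ℝ C := by
    rintro _ ⟨p, j, k, hp, hj, hk, rfl⟩ _ ⟨p', j', k', hp', hj', hk', rfl⟩ s t hs ht -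
    refine ⟨s • p + t • p', s • j + t • j', s • k + t • k',
      add_nonneg (smul_nonneg hs hp) (smul_nonneg ht hp'), ?_, ?_, ?_⟩
    · exact J.add_mem (J.smul_of_tower_mem s hj) (J.smul_of_tower_mem t hj')
    · exact (IsSelfAdjoint.smul (.all s) hk).add (IsSelfAdjoint.smul (.all t) hk')
    · simp only [smul_add, smul_comm _ Complex.I]
      abel
  have hdisj : Disjoint (Metric.ball (-(star a * a)) (r ^ 2)) C := by
    rw [Set.disjoint_left]
    rintro _ hx ⟨p, j, k, hp, hj, hk, rfl⟩
    rw [Metric.mem_ball, dist_eq_norm, sub_neg_eq_add, add_comm] at hx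
    exact absurd (sq_le_norm_star_mul_self_add hl hr hr0.le hdist hp hj hk) (not_le.2 hx)
  obtain ⟨g, s, hg1, hg2⟩ :=
    geometric_hahn_banach_open (convex_ball _ _) Metric.isOpen_ball hC hdisj
  have hs : s ≤ 0 := by
    simpa using hg2 0 ⟨0, 0, 0, le_rfl, J.zero_mem, .zero _, by simp⟩
  -- `C` is a cone, on which `g` is bounded below
  have hCn : ∀ x ∈ C, 0 ≤ g x := by
    rintro _ ⟨p, j, k, hp, hj, hk, rfl⟩
    set x := p + j + Complex.I • k with hx
    by_contra! hneg
    obtain ⟨n, hn⟩ := exists_nat_gt (s / g x)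
    have h := hg2 ((n : ℝ) • x) ⟨(n : ℝ) • p, (n : ℝ) • j, (n : ℝ) • k,
      smul_nonneg n.cast_nonneg hp, J.smul_of_tower_mem _ hj, IsSelfAdjoint.smul (.all _) hk, by
        simp only [hx, smul_add, smul_comm _ Complex.I]⟩
    rw [map_smul, smul_eq_mul] at h
    rw [div_lt_iff_of_neg hneg] at hn
    linarith
  have hgpos : ∀ p, 0 ≤ p → 0 ≤ g p := fun p hp =>
    hCn _ ⟨p, 0, 0, hp, J.zero_mem, .zero _, by simp⟩
  have hgJ : ∀ j ∈ J, g j = 0 := fun j hj => by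
    refine le_antisymm ?_ (hCn _ ⟨0, j, 0, le_rfl, hj, .zero _, by simp⟩)
    simpa using hCn (-j) ⟨0, -j, 0, le_rfl, J.neg_mem hj, .zero _, by simp⟩
  have hgI : ∀ k, IsSelfAdjoint k → g (Complex.I • k) = 0 := fun k hk => by
    refine le_antisymm ?_ (hCn _ ⟨0, 0, k, le_rfl, J.zero_mem, hk, by simp⟩)
    simpa using hCn (-(Complex.I • k)) ⟨0, 0, -k, le_rfl, J.zero_mem, hk.neg, by simp⟩
  let F : B →ₗ[ℂ] ℂ := Module.Dual.extendRCLike (g : B →ₗ[ℝ] ℝ)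
  have hF : ∀ x, F x = (g x : ℂ) - Complex.I * (g (Complex.I • x) : ℂ) := fun x => rfl
  have hFpos : ∀ x, 0 ≤ x → 0 ≤ F x := fun x hx => by
    rw [hF, hgI x (.of_nonneg hx)]
    simpa using hgpos x hx
  refine ⟨⟨F, fun x y hxy => ?_⟩, fun j hj => ?_, ?_⟩
  · have := hFpos (y - x) (sub_nonneg.2 hxy)
    rwa [map_sub, sub_nonneg] at this
  · change F j = 0
    rw [hF, hgJ j hj, hgJ _ (J.smul_mem _ hj)]
    simp
  · change 0 < (F (star a * a)).re
    rw [hF, hgI _ (.star_mul_self a)]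
    have := hg1 _ (Metric.mem_ball_self (by positivity))
    rw [map_neg] at this
    simp only [Complex.ofReal_zero, mul_zero, sub_zero, Complex.ofReal_re]
    linarith

end States

/-! ### Pure states that vanish on an ideal -/

section PureStates

open scoped ComplexOrder

variable {B : Type u} [CStarAlgebra B] [PartialOrder B] [StarOrderedRing B]

theorem PositiveLinearMap.norm_apply_le_four_mul (f : B →ₚ[ℂ] ℂ) (x : B) :
    ‖f x‖ ≤ 4 * (‖f 1‖ * ‖x‖) := by
  obtain ⟨y, hy0, hyn, hy⟩ := CStarAlgebra.exists_sum_four_nonneg x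
  conv_lhs => rw [hy]
  simp only [map_sum, map_smul]
  refine (norm_sum_le _ _).trans ?_
  simp only [norm_smul, norm_pow, Complex.norm_I, one_pow, one_mul]
  refine (Finset.sum_le_card_nsmul _ _ (‖f 1‖ * ‖x‖) fun i _ => ?_).trans (by simp)
  exact (f.norm_apply_le_of_nonneg _ (hy0 i)).trans (by gcongr; exact hyn i)

/-- A linear functional that is nonnegative on positive elements, as a positive linear map. -/
def LinearMap.toPositive (f : B →ₗ[ℂ] ℂ) (hf : ∀ x, 0 ≤ x → 0 ≤ f x) : B →ₚ[ℂ] ℂ :=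
  ⟨f, fun x y hxy => by simpa using hf (y - x) (sub_nonneg.2 hxy)⟩

@[simp]
theorem LinearMap.toPositive_apply (f : B →ₗ[ℂ] ℂ) (hf : ∀ x, 0 ≤ x → 0 ≤ f x) (x : B) :
    f.toPositive hf x = f x := rfl

/-- The states of `B` that vanish on `J`, as a set of functions, so that the weak topology is that
of pointwise convergence. -/
def statesVanishingOn (J : Submodule ℂ B) : Set (B → ℂ) :=
  {φ | ∃ f : B →ₚ[ℂ] ℂ, f 1 = 1 ∧ (∀ j ∈ J, f j = 0) ∧ φ = f}

theorem isCompact_statesVanishingOn (J : Submodule ℂ B) : IsCompact (statesVanishingOn J) := by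
  have hK : IsCompact (Set.univ.pi fun x : B => Metric.closedBall (0 : ℂ) (4 * ‖x‖)) :=
    isCompact_univ_pi fun x => isCompact_closedBall _ _
  refine hK.of_isClosed_subset ?_ ?_
  · have : statesVanishingOn J = {φ | (∀ x y, φ (x + y) = φ x + φ y) ∧
        (∀ (c : ℂ) x, φ (c • x) = c * φ x) ∧ (∀ x, 0 ≤ x → 0 ≤ φ x) ∧ φ 1 = 1 ∧
        ∀ j ∈ J, φ j = 0} := by
      ext φ
      constructor
      · rintro ⟨f, h1, hJ, rfl⟩
        exact ⟨map_add f, fun c x => by simp, fun x hx => f.map_nonneg hx, h1, hJ⟩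
      · rintro ⟨hadd, hsmul, hpos, h1, hJ⟩
        exact ⟨LinearMap.toPositive ⟨⟨φ, hadd⟩, hsmul⟩ hpos, h1, hJ, rfl⟩
    rw [this]
    simp only [Set.ofPred_and, Set.ofPred_forall]
    refine .inter (isClosed_iInter fun x => isClosed_iInter fun y => isClosed_eq ?_ ?_)
      (.inter (isClosed_iInter fun c => isClosed_iInter fun x => isClosed_eq ?_ ?_)
      (.inter (isClosed_iInter fun x => isClosed_iInter fun _ => isClosed_le ?_ ?_)
      (.inter (isClosed_eq ?_ ?_)
      (isClosed_iInter fun j => isClosed_iInter fun _ => isClosed_eq ?_ ?_)))) <;> fun_prop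
  · rintro _ ⟨f, h1, -, rfl⟩ x -
    simpa [h1] using f.norm_apply_le_four_mul x

/-- An extreme point of the set of states that vanish on `J` is pure: it dominates only its own
multiples. -/
theorem exists_eq_mul_of_mem_extremePoints {J : Submodule ℂ B} {f : B →ₚ[ℂ] ℂ}
    (hf : ⇑f ∈ (statesVanishingOn J).extremePoints ℝ) {g : B →ₗ[ℂ] ℂ}
    (hg0 : ∀ x, 0 ≤ x → 0 ≤ g x) (hgf : ∀ x, 0 ≤ x → g x ≤ f x) (hgJ : ∀ j ∈ J, g j = 0) :
    ∃ t : ℂ, ∀ x, g x = t * f x := by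
  obtain ⟨⟨f', hf1, hfJ, e⟩, hext⟩ := mem_extremePoints_iff_left.1 hf
  obtain rfl : f = f' := DFunLike.coe_injective e
  -- the remainder `f - g`
  let k : B →ₗ[ℂ] ℂ := f.toLinearMap - g
  have hk : ∀ x, k x = f x - g x := fun x => rfl
  have hk0 : ∀ x, 0 ≤ x → 0 ≤ k x := fun x hx => by
    rw [hk, sub_nonneg]
    exact hgf x hx
  have hzero : ∀ (l : B →ₗ[ℂ] ℂ), (∀ x, 0 ≤ x → 0 ≤ l x) → l 1 = 0 → ∀ x, l x = 0 := by
    intro l hl h1 x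
    have := (l.toPositive hl).norm_apply_le_four_mul x
    simpa [h1] using this
  have hre : ∀ z : ℂ, 0 ≤ z → ((z.re : ℝ) : ℂ) = z := fun z hz =>
    (Complex.eq_re_of_ofReal_le hz).symm
  have hs := hre _ (hg0 1 zero_le_one)
  have ht := hre _ (hk0 1 zero_le_one)
  have hs0 : 0 ≤ (g 1).re := (Complex.nonneg_iff.1 (hg0 1 zero_le_one)).1
  have ht0 : 0 ≤ (k 1).re := (Complex.nonneg_iff.1 (hk0 1 zero_le_one)).1
  set s := (g 1).re
  set t := (k 1).re
  have hst : s + t = 1 := by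
    have : (s : ℂ) + t = 1 := by rw [hs, ht, hk, hf1]; ring
    exact_mod_cast this
  rcases hs0.eq_or_lt with h | hspos
  · refine ⟨0, fun x => ?_⟩
    rw [zero_mul]
    exact hzero g hg0 (by rw [← hs, ← h]; simp) x
  rcases ht0.eq_or_lt with h | htpos
  · refine ⟨1, fun x => ?_⟩
    have := hzero k hk0 (by rw [← ht, ← h]; simp) x
    rw [hk, sub_eq_zero] at this
    rw [one_mul, this]
  · have hmem : ∀ (l : B →ₗ[ℂ] ℂ) (r : ℝ), (∀ x, 0 ≤ x → 0 ≤ l x) → (∀ j ∈ J, l j = 0) → 0 < r →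
        (r : ℂ) = l 1 → (fun x => (r : ℂ)⁻¹ * l x) ∈ statesVanishingOn J := by
      intro l r hl hlJ hr e
      refine ⟨((r : ℂ)⁻¹ • l).toPositive fun x hx => ?_, ?_, fun j hj => ?_, rfl⟩
      · rw [LinearMap.smul_apply, smul_eq_mul]
        exact mul_nonneg (by rw [← Complex.ofReal_inv]; exact_mod_cast (inv_pos.2 hr).le) (hl x hx)
      · rw [LinearMap.toPositive_apply, LinearMap.smul_apply, smul_eq_mul, ← e]
        exact inv_mul_cancel₀ (by exact_mod_cast hr.ne')
      · rw [LinearMap.toPositive_apply, LinearMap.smul_apply, hlJ j hj, smul_zero]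
    have hsC : (s : ℂ) ≠ 0 := by exact_mod_cast hspos.ne'
    have htC : (t : ℂ) ≠ 0 := by exact_mod_cast htpos.ne'
    have := hext _ (hmem g s hg0 hgJ hspos hs) _
      (hmem k t hk0 (fun j hj => by rw [hk, hfJ j hj, hgJ j hj, sub_zero]) htpos ht)
      ⟨s, t, hspos, htpos, hst, by
        funext x
        simp only [Pi.add_apply, Pi.smul_apply, Complex.real_smul]
        rw [mul_inv_cancel_left₀ hsC, mul_inv_cancel_left₀ htC, hk]
        ring⟩
    refine ⟨s, fun x => ?_⟩
    rw [← congrFun this x, mul_inv_cancel_left₀ hsC]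

/-- For `a` outside of the closed ideal `J` there is a pure state that vanishes on `J`, but not
at `a⋆a`: an extreme point of the face on which the evaluation at `a⋆a` is maximal. -/
theorem exists_extremePoint_statesVanishingOn {J : Submodule ℂ B} (hJ : IsClosed (J : Set B))
    (hl : ∀ b, ∀ j ∈ J, b * j ∈ J) (hr : ∀ b, ∀ j ∈ J, j * b ∈ J) {a : B} (ha : a ∉ J) :
    ∃ f : B →ₚ[ℂ] ℂ, ⇑f ∈ (statesVanishingOn J).extremePoints ℝ ∧ f (star a * a) ≠ 0 := by
  obtain ⟨f₀, hf₀J, hf₀⟩ := exists_positive_vanishing hJ hl hr ha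
  have h1 : 0 ≤ f₀ 1 := f₀.map_nonneg zero_le_one
  have h1' : f₀ 1 ≠ 0 := fun h => by
    have := f₀.norm_apply_le_four_mul (star a * a)
    rw [h] at this
    have h0 : f₀ (star a * a) = 0 := by simpa using this
    simp [h0] at hf₀
  have hinv : 0 < (f₀ 1)⁻¹ := by
    rw [inv_pos]
    exact lt_of_le_of_ne h1 h1'.symm
  let l : StrongDual ℝ (B → ℂ) :=
    Complex.reCLM.comp (ContinuousLinearMap.proj (R := ℝ) (φ := fun _ : B => ℂ) (star a * a))
  have hl' : ∀ φ, l φ = (φ (star a * a)).re := fun φ => rfl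
  let g₀ : B →ₚ[ℂ] ℂ := ((f₀ 1)⁻¹ • f₀.toLinearMap).toPositive fun x hx =>
    mul_nonneg hinv.le (f₀.map_nonneg hx)
  have hg₀ : ∀ x, g₀ x = (f₀ 1)⁻¹ * f₀ x := fun x => rfl
  have hg₀S : ⇑g₀ ∈ statesVanishingOn J :=
    ⟨g₀, by rw [hg₀, inv_mul_cancel₀ h1'], fun j hj => by rw [hg₀, hf₀J j hj, mul_zero], rfl⟩
  have hlg₀ : 0 < l g₀ := by
    have h2 : 0 < f₀ (star a * a) := by
      have h3 := f₀.map_nonneg (star_mul_self_nonneg a)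
      refine lt_of_le_of_ne h3 fun h => ?_
      simp [← h] at hf₀
    have h4 : 0 < g₀ (star a * a) := by
      rw [hg₀]
      exact mul_pos hinv h2
    exact (Complex.pos_iff.1 h4).1
  have hexp : IsExposed ℝ (statesVanishingOn J) (l.toExposed (statesVanishingOn J)) :=
    ContinuousLinearMap.toExposed.isExposed
  have hS := isCompact_statesVanishingOn J
  obtain ⟨φm, hφm, hmax⟩ := hS.exists_isMaxOn ⟨_, hg₀S⟩ l.continuous.continuousOn
  obtain ⟨φ, hφ⟩ := (hexp.isCompact hS).extremePoints_nonempty ⟨φm, hφm, fun y hy => hmax hy⟩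
  have hφS := hexp.isExtreme.extremePoints_subset_extremePoints hφ
  obtain ⟨f, -, -, rfl⟩ := extremePoints_subset hφS
  refine ⟨f, hφS, fun h => ?_⟩
  have h5 := (extremePoints_subset hφ).2 _ hg₀S
  rw [hl' f, h] at h5
  exact absurd hlg₀ (not_lt.2 (by simpa using h5))

end PureStates

/-! ### Irreducible GNS representations -/

section GNS

open scoped ComplexOrder InnerProductSpace

variable {B : Type u} [CStarAlgebra B] [PartialOrder B] [StarOrderedRing B]

/-- The cyclic vector of the GNS representation. -/
def gnsVector (f : B →ₚ[ℂ] ℂ) : f.GNS := (f.toPreGNS 1 : f.PreGNS)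

theorem gnsStarAlgHom_gnsVector (f : B →ₚ[ℂ] ℂ) (x : B) :
    f.gnsStarAlgHom x (gnsVector f) = (f.toPreGNS x : f.PreGNS) := by
  change f.gnsNonUnitalStarAlgHom x (f.toPreGNS 1 : f.PreGNS) = _
  rw [f.gnsNonUnitalStarAlgHom_apply_coe]
  simp

theorem inner_gnsVector (f : B →ₚ[ℂ] ℂ) (x y : B) :
    ⟪f.gnsStarAlgHom x (gnsVector f), f.gnsStarAlgHom y (gnsVector f)⟫_ℂ = f (star x * y) := by
  rw [gnsStarAlgHom_gnsVector, gnsStarAlgHom_gnsVector, UniformSpace.Completion.inner_coe]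
  rfl

/-- A bounded operator on the GNS space is determined by its values on the vectors `π(x)ξ`. -/
theorem gns_clm_ext (f : B →ₚ[ℂ] ℂ) {S T : f.GNS →L[ℂ] f.GNS}
    (h : ∀ x, S (f.gnsStarAlgHom x (gnsVector f)) = T (f.gnsStarAlgHom x (gnsVector f))) :
    S = T := by
  ext v
  induction v using UniformSpace.Completion.induction_on with
  | hp => exact isClosed_eq S.continuous T.continuous
  | ih v =>
    have := h (f.ofPreGNS v)
    rwa [gnsStarAlgHom_gnsVector, f.toPreGNS_ofPreGNS] at this

theorem gns_eq_zero_of_inner (f : B →ₚ[ℂ] ℂ) {v : f.GNS}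
    (h : ∀ x, ⟪f.gnsStarAlgHom x (gnsVector f), v⟫_ℂ = 0) : v = 0 := by
  have : ∀ w : f.GNS, ⟪w, v⟫_ℂ = 0 := by
    intro w
    induction w using UniformSpace.Completion.induction_on with
    | hp => exact isClosed_eq (by fun_prop) continuous_const
    | ih w =>
      have := h (f.ofPreGNS w)
      rwa [gnsStarAlgHom_gnsVector, f.toPreGNS_ofPreGNS] at this
  exact inner_self_eq_zero.1 (this v)

/-- The projection onto a closed invariant subspace commutes with the representation. -/
theorem starProjection_apply_comm {B : Type*} [CStarAlgebra B] {H : Type*}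
    [NormedAddCommGroup H] [InnerProductSpace ℂ H]
    [CompleteSpace H] (π : B →⋆ₐ[ℂ] (H →L[ℂ] H)) (M : Submodule ℂ H) [M.HasOrthogonalProjection]
    (hM : ∀ b, ∀ v ∈ M, π b v ∈ M) (b : B) (v : H) :
    M.starProjection (π b v) = π b (M.starProjection v) := by
  refine (Submodule.eq_starProjection_of_mem_of_inner_eq_zero
    (hM b _ (Submodule.starProjection_apply_mem M v)) fun w hw => ?_)
  rw [← map_sub, ← ContinuousLinearMap.adjoint_inner_right, ← ContinuousLinearMap.star_eq_adjoint,
    ← map_star]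
  exact Submodule.starProjection_inner_eq_zero v _ (hM _ _ hw)

theorem gns_eq_zero_of_mem {J : Submodule ℂ B} (hl : ∀ b, ∀ j ∈ J, b * j ∈ J)
    (hr : ∀ b, ∀ j ∈ J, j * b ∈ J) {f : B →ₚ[ℂ] ℂ} (hf : ∀ j ∈ J, f j = 0) {j : B} (hj : j ∈ J) :
    f.gnsStarAlgHom j = 0 := by
  refine gns_clm_ext f fun x => gns_eq_zero_of_inner f fun y => ?_
  rw [← mul_apply_eq_comp, ← map_mul, inner_gnsVector]
  exact hf _ (hl _ _ (hr _ _ hj))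

/-- The GNS representation of a pure state is irreducible: the projection `P` onto an invariant
subspace commutes with the representation `π`, so that `x ↦ ⟪ξ, P π(x) ξ⟫` is dominated by the
state and hence a multiple of it, which makes `P` a scalar. -/
theorem gns_irreducible {J : Submodule ℂ B} (hl : ∀ b, ∀ j ∈ J, b * j ∈ J)
    (hr : ∀ b, ∀ j ∈ J, j * b ∈ J) {f : B →ₚ[ℂ] ℂ}
    (hf : ⇑f ∈ (statesVanishingOn J).extremePoints ℝ) (M : Submodule ℂ f.GNS)
    (hMc : IsClosed (M : Set f.GNS)) (hM : ∀ b, ∀ v ∈ M, f.gnsStarAlgHom b v ∈ M) :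
    M = ⊥ ∨ M = ⊤ := by
  have : CompleteSpace M := hMc.completeSpace_coe
  have hfJ : ∀ j ∈ J, f j = 0 := by
    obtain ⟨f', -, h, e⟩ := extremePoints_subset hf
    obtain rfl : f = f' := DFunLike.coe_injective e
    exact h
  set π := f.gnsStarAlgHom
  set ξ := gnsVector f
  let P := M.starProjection
  have hP : ∀ b v, P (π b v) = π b (P v) := starProjection_apply_comm π M hM
  have hPP : ∀ v w, ⟪P v, P w⟫_ℂ = ⟪v, P w⟫_ℂ := fun v w => by
    rw [Submodule.inner_starProjection_left_eq_right,
      Submodule.starProjection_eq_self_iff.2 (Submodule.starProjection_apply_mem M w)]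
  have hin : ∀ x y, ⟪π x ξ, P (π y ξ)⟫_ℂ = ⟪ξ, P (π (star x * y) ξ)⟫_ℂ := fun x y => by
    rw [map_mul, mul_apply_eq_comp, hP (star x), map_star,
      ContinuousLinearMap.star_eq_adjoint, ContinuousLinearMap.adjoint_inner_right]
  let g : B →ₗ[ℂ] ℂ :=
    { toFun := fun x => ⟪ξ, P (π x ξ)⟫_ℂ
      map_add' := fun x y => by simp [inner_add_right]
      map_smul' := fun c x => by simp [inner_smul_right] }
  have hg : ∀ x y, g (star x * y) = ⟪π x ξ, P (π y ξ)⟫_ℂ := fun x y => (hin x y).symm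
  have hgn : ∀ x, g (star x * x) = ((‖P (π x ξ)‖ ^ 2 : ℝ) : ℂ) := fun x => by
    rw [hg, ← hPP, inner_self_eq_norm_sq_to_K]
    norm_cast
  have hfn : ∀ x, f (star x * x) = ((‖π x ξ‖ ^ 2 : ℝ) : ℂ) := fun x => by
    rw [← inner_gnsVector, inner_self_eq_norm_sq_to_K]
    norm_cast
  have hfact : ∀ x : B, 0 ≤ x → ∃ y, x = star y * y := fun x hx =>
    CStarAlgebra.nonneg_iff_eq_star_mul_self.1 hx
  obtain ⟨t, ht⟩ := exists_eq_mul_of_mem_extremePoints hf (g := g)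
    (fun x hx => by
      obtain ⟨y, rfl⟩ := hfact x hx
      rw [hgn]
      exact Complex.zero_le_real.2 (sq_nonneg _))
    (fun x hx => by
      obtain ⟨y, rfl⟩ := hfact x hx
      rw [hgn, hfn]
      have : ‖P (π y ξ)‖ ≤ ‖π y ξ‖ := Submodule.norm_starProjection_apply_le M _
      exact Complex.real_le_real.2 (pow_le_pow_left₀ (norm_nonneg _) this 2))
    (fun j hj => by
      change ⟪ξ, P (π j ξ)⟫_ℂ = 0
      rw [show π j = 0 from gns_eq_zero_of_mem hl hr hfJ hj]
      simp)
  have hPt : P = t • ContinuousLinearMap.id ℂ f.GNS := by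
    refine gns_clm_ext f fun x => sub_eq_zero.1 (gns_eq_zero_of_inner f fun y => ?_)
    change ⟪π y ξ, P (π x ξ) - t • π x ξ⟫_ℂ = 0
    rw [inner_sub_right, inner_smul_right, ← hg, ht, ← inner_gnsVector, sub_self]
  by_cases h0 : t = 0
  · left
    rw [eq_bot_iff]
    intro v hv
    have h1 : P v = v := Submodule.starProjection_eq_self_iff.2 hv
    rw [hPt, h0, zero_smul] at h1
    exact h1.symm
  · right
    rw [eq_top_iff]
    intro v _
    have h1 : P v ∈ M := Submodule.starProjection_apply_mem M v
    rw [hPt] at h1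
    simpa [h0] using M.smul_mem t⁻¹ h1

end GNS

/-! ### Closed ideals and irreducible representations -/

section ClosedIdeals

variable {A : Type u} [NonUnitalCStarAlgebra A]

/-- A closed ideal of the ring `A` is a complex subspace: if `e` runs through an approximate unit,
then the elements `i * (c • e)` of the ideal converge to `c • i`. -/
theorem TwoSidedIdeal.smul_mem_of_isClosed {I : TwoSidedIdeal A} (hI : IsClosed (I : Set A)) (c : ℂ)
    {i : A} (hi : i ∈ I) : c • i ∈ I := by
  let : PartialOrder A := CStarAlgebra.spectralOrder A
  have : StarOrderedRing A := CStarAlgebra.spectralOrderedRing A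
  have hu := CStarAlgebra.increasingApproximateUnit A
  have := hu.neBot
  have h : Filter.Tendsto (fun e => c • (i * e)) (CStarAlgebra.approximateUnit A) (𝓝 (c • i)) :=
    (hu.tendsto_mul_left i).const_smul c
  refine hI.mem_of_tendsto h (.of_forall fun e => ?_)
  rw [← mul_smul_comm]
  exact I.mul_mem_right _ _ hi

/-- A closed two-sided ideal as a complex subspace. -/
def TwoSidedIdeal.toComplexSubmodule (I : TwoSidedIdeal A) (hI : IsClosed (I : Set A)) :
    Submodule ℂ A where
  carrier := I
  add_mem' := I.add_mem
  zero_mem' := I.zero_mem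
  smul_mem' c _ hi := I.smul_mem_of_isClosed hI c hi

/-- Every proper closed two-sided ideal is annihilated by an irreducible representation. It is
found as the restriction to `A` of the GNS representation of the unitization of `A` for a pure
state. -/
theorem exists_irrRep_le_ker {I : TwoSidedIdeal A} (hI : IsClosed (I : Set A)) (hne : I ≠ ⊤) :
    ∃ ρ : IrrRep A, I ≤ ρ.ker := by
  obtain ⟨a, ha⟩ : ∃ a, a ∉ I := by
    by_contra! h
    exact hne (eq_top_iff.2 fun a _ => h a)
  let : PartialOrder A := CStarAlgebra.spectralOrder A
  have : StarOrderedRing A := CStarAlgebra.spectralOrderedRing A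
  let ι : A →⋆ₙₐ[ℂ] Unitization ℂ A := Unitization.inrNonUnitalStarAlgHom ℂ A
  have hι : Isometry ι := Unitization.isometry_inr
  let J : Submodule ℂ (Unitization ℂ A) :=
    (I.toComplexSubmodule hI).map (ι : A →ₗ[ℂ] Unitization ℂ A)
  have hJmem : ∀ x, x ∈ J ↔ ∃ i ∈ I, ι i = x := fun x => Iff.rfl
  have hJc : IsClosed (J : Set (Unitization ℂ A)) := hι.isClosedEmbedding.isClosedMap _ hI
  have hdec : ∀ b : Unitization ℂ A, b = algebraMap ℂ _ b.fst + ι b.snd := fun b =>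
    (Unitization.inl_fst_add_inr_snd_eq b).symm
  have hl : ∀ b, ∀ j ∈ J, b * j ∈ J := by
    rintro b _ ⟨i, hi, rfl⟩
    refine ⟨b.fst • i + b.snd * i,
      I.add_mem (I.smul_mem_of_isClosed hI _ hi) (I.mul_mem_left _ _ hi), ?_⟩
    conv_rhs => rw [hdec b]
    change ι _ = _ * ι i
    rw [map_add, map_smul, map_mul, add_mul, Algebra.smul_def]
  have hr : ∀ b, ∀ j ∈ J, j * b ∈ J := by
    rintro b _ ⟨i, hi, rfl⟩
    refine ⟨b.fst • i + i * b.snd,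
      I.add_mem (I.smul_mem_of_isClosed hI _ hi) (I.mul_mem_right _ _ hi), ?_⟩
    conv_rhs => rw [hdec b]
    change ι _ = ι i * _
    rw [map_add, map_smul, map_mul, mul_add, Algebra.smul_def, Algebra.commutes]
  have haJ : ι a ∉ J := by
    rintro ⟨i, hi, e⟩
    obtain rfl : i = a := hι.injective e
    exact ha hi
  obtain ⟨f, hf, hfa⟩ := exists_extremePoint_statesVanishingOn hJc hl hr haJ
  obtain ⟨f', -, hfJ, e⟩ := extremePoints_subset hf
  obtain rfl : f = f' := DFunLike.coe_injective e
  let π : A →⋆ₙₐ[ℂ] (f.GNS →L[ℂ] f.GNS) := (f.gnsStarAlgHom : _ →⋆ₙₐ[ℂ] _).comp ι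
  have hπ : ∀ x, π x = f.gnsStarAlgHom (ι x) := fun x => rfl
  refine ⟨⟨f.GNS, π, ⟨a, fun h => hfa ?_⟩, fun M hMc hM => ?_⟩, fun i hi => ?_⟩
  · rw [hπ] at h
    rw [← inner_gnsVector, h]
    simp
  · refine gns_irreducible hl hr hf M hMc fun b v hv => ?_
    rw [hdec b, map_add, AlgHomClass.commutes]
    exact M.add_mem (M.smul_mem _ hv) (hM _ v hv)
  · rw [IrrRep.mem_ker]
    exact gns_eq_zero_of_mem hl hr hfJ ⟨i, hi, rfl⟩

end ClosedIdeals

/-! ### Restriction and extension of weights -/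

section Rank

variable {X Y : Type u} [TopologicalSpace X] [TopologicalSpace Y]

open Ordinal in
/-- The rank of `w` is at most `ω * γ + n` if and only if `w` is at most `n` at all points whose
order is not smaller than `γ`; this already forces all orders to be at most `γ`. -/
theorem weightRank_le_iff {w : X → ℕ∞} {γ : Ordinal.{u}} {n : ℕ} :
    weightRank w ≤ ((ω * γ + n : Ordinal.{u}) : WithTop Ordinal.{u}) ↔
      ∀ x, w x ≤ (n : ℕ∞) ∨ ∃ δ < γ, x ∈ weightLevel w δ := by
  rw [weightRank, iSup_le_iff]
  have hlt : ∀ (δ : Ordinal.{u}) (m : ℕ), ω * δ + m < ω * Order.succ δ := fun δ m => by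
    rw [Ordinal.mul_succ]
    gcongr
    exact Ordinal.natCast_lt_omega0 m
  constructor
  · intro h x
    have hx := h x
    have ho : weightOrder w x ≠ ⊤ := fun e => by
      rw [weightRankAt, e, WithTop.map_top] at hx
      exact absurd hx (WithTop.not_top_le_coe _)
    have hw : w x ≠ ⊤ := fun e => ho (weightOrder_eq_top e)
    obtain ⟨δ, hδ⟩ := WithTop.ne_top_iff_exists.1 ho
    rw [weightRankAt, ← hδ, WithTop.map_coe, WithTop.coe_le_coe] at hx
    have hδγ : δ ≤ γ := by
      by_contra! hγδ
      refine absurd ((le_self_add.trans hx).trans_lt (hlt γ n)) (not_lt.2 ?_)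
      gcongr
      exact Order.succ_le_of_lt hγδ
    rcases hδγ.lt_or_eq with h1 | rfl
    · exact .inr ⟨δ, h1, weightOrder_le_iff.1 hδ.ge⟩
    · left
      rw [add_le_add_iff_left, Nat.cast_le] at hx
      rw [← ENat.natCast_toNat hw]
      exact_mod_cast hx
  · intro h x
    have ho : weightOrder w x ≤ γ :=
      weightOrder_le_iff.2 (mem_weightLevel.2 ⟨n, .of_forall h⟩)
    obtain ⟨δ, hδ⟩ := WithTop.ne_top_iff_exists.1 (ho.trans_lt (WithTop.coe_lt_top γ)).ne
    rw [← hδ, WithTop.coe_le_coe] at ho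
    rw [weightRankAt, ← hδ, WithTop.map_coe, WithTop.coe_le_coe]
    have hsucc : ∀ ε < γ, δ ≤ ε → ω * δ + ((w x).toNat : Ordinal.{u}) ≤ ω * γ + n := by
      intro ε hε hδε
      refine (hlt δ _).le.trans (le_trans ?_ le_self_add)
      gcongr
      exact Order.succ_le_of_lt (hδε.trans_lt hε)
    rcases h x with h1 | ⟨ε, hε, h1⟩
    · have : (w x).toNat ≤ n := ENat.toNat_le_of_le_natCast h1
      gcongr
    · refine hsucc ε hε ?_
      have := weightOrder_le_iff.2 h1
      rwa [← hδ, WithTop.coe_le_coe] at this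

/-- Every ordinal is of the form `ω * γ + n`. -/
theorem Ordinal.exists_eq_omega0_mul_add_natCast (β : Ordinal.{u}) :
    ∃ (γ : Ordinal.{u}) (n : ℕ), β = Ordinal.omega0 * γ + n := by
  obtain ⟨n, hn⟩ := Ordinal.lt_omega0.1 (Ordinal.mod_lt β Ordinal.omega0_ne_zero)
  exact ⟨β / Ordinal.omega0, n, by rw [← hn, Ordinal.div_add_mod]⟩

theorem mem_weightLevel_comp {w : X → ℕ∞} {f : Y → X} (hf : Continuous f) (δ : Ordinal.{u}) :
    ∀ y, f y ∈ weightLevel w δ → y ∈ weightLevel (w ∘ f) δ := by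
  induction δ using WellFoundedLT.induction with
  | ind δ ih =>
    intro y hy
    obtain ⟨n, hn⟩ := mem_weightLevel.1 hy
    refine mem_weightLevel.2 ⟨n, (hf.continuousAt.eventually hn).mono fun z hz => hz.imp id ?_⟩
    rintro ⟨ε, hε, hz⟩
    exact ⟨ε, hε, ih ε hε z hz⟩

theorem weightRank_comp_le {w : X → ℕ∞} {f : Y → X} (hf : Continuous f) {β : Ordinal.{u}}
    (h : weightRank w ≤ β) : weightRank (w ∘ f) ≤ β := by
  obtain ⟨γ, n, rfl⟩ := β.exists_eq_omega0_mul_add_natCast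
  rw [weightRank_le_iff] at h ⊢
  refine fun y => (h (f y)).imp id ?_
  rintro ⟨δ, hδ, hy⟩
  exact ⟨δ, hδ, mem_weightLevel_comp hf δ y hy⟩

theorem mem_weightLevel_of_isOpenEmbedding {w : Y → ℕ∞} {v : X → ℕ∞} {f : Y → X}
    (hf : IsOpenEmbedding f) (hvw : ∀ y, v (f y) ≤ w y) (δ : Ordinal.{u}) :
    ∀ y ∈ weightLevel w δ, f y ∈ weightLevel v δ := by
  induction δ using WellFoundedLT.induction with
  | ind δ ih =>
    intro y hy
    obtain ⟨n, hn⟩ := mem_weightLevel.1 hy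
    refine mem_weightLevel.2 ⟨n, ?_⟩
    rw [← hf.map_nhds_eq, Filter.eventually_map]
    refine hn.mono fun z hz => hz.imp (hvw z).trans ?_
    rintro ⟨ε, hε, hz⟩
    exact ⟨ε, hε, ih ε hε z hz⟩

/-- Extension by zero from an open set does not increase the rank: the points at the boundary have
weight `0`, so nothing is required of them. -/
theorem weightRank_le_of_isOpenEmbedding {w : Y → ℕ∞} {v : X → ℕ∞} {f : Y → X}
    (hf : IsOpenEmbedding f) (hvw : ∀ y, v (f y) ≤ w y) (hv : ∀ x ∉ Set.range f, v x = 0)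
    {β : Ordinal.{u}} (h : weightRank w ≤ β) : weightRank v ≤ β := by
  obtain ⟨γ, n, rfl⟩ := β.exists_eq_omega0_mul_add_natCast
  rw [weightRank_le_iff] at h ⊢
  intro x
  by_cases hx : x ∈ Set.range f
  · obtain ⟨y, rfl⟩ := hx
    refine (h y).imp (hvw y).trans ?_
    rintro ⟨δ, hδ, hy⟩
    exact ⟨δ, hδ, mem_weightLevel_of_isOpenEmbedding hf hvw δ y hy⟩
  · exact .inl (by simp [hv x hx])

end Rank

/-! ### Local sections and the Fell ideals -/

section LocalSections

variable {A : Type u} [NonUnitalCStarAlgebra A]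

theorem IrrRep.rank_mul_le (ρ : IrrRep A) (x b : A) : ρ.rank (x * b) ≤ ρ.rank b := by
  rw [IrrRep.rank, IrrRep.rank, map_mul]
  exact OrderHomClass.mono Cardinal.toENat (LinearMap.rank_comp_le_right _ _)

theorem pedersenFunction_mul_le (x b : A) (t : PrimitiveSpectrum A) :
    pedersenFunction (x * b) t ≤ pedersenFunction b t :=
  iInf_mono fun ρ => ρ.1.rank_mul_le x b

theorem pedersenFunction_eq_zero {b : A} {t : PrimitiveSpectrum A} (h : b ∈ t.1) :
    pedersenFunction b t = 0 := by
  obtain ⟨P, ρ, rfl⟩ := t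
  refine le_antisymm (iInf_le_of_le ⟨ρ, rfl⟩ ?_) bot_le
  rw [IrrRep.rank, IrrRep.mem_ker.1 h]
  simp

theorem isOpen_setOf_notMem (b : A) : IsOpen {t : PrimitiveSpectrum A | b ∉ t.1} := by
  refine ⟨closedIdealSpan {b}, isClosed_closedIdealSpan _, ?_⟩
  ext t
  refine not_congr ⟨fun h => closedIdealSpan_le t.isClosed (by simpa using h), fun h => ?_⟩
  exact h (subset_closedIdealSpan _ rfl)

/-- The image of an irreducible representation is a prime ring; this is the statement for elements. -/
theorem IrrRep.exists_mul_mul_ne_zero (π : IrrRep A) {j b : A} (hj : π.toHom j ≠ 0)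
    (hb : π.toHom b ≠ 0) : ∃ x, π.toHom (j * x * b) ≠ 0 := by
  by_contra! h
  -- the closed invariant subspace of the vectors that are killed by `π(j)π(a)` for all `a`
  let M : Submodule ℂ π.H := ⨅ a : A, LinearMap.ker (π.toHom j ∘L π.toHom a).toLinearMap
  have hM : ∀ ξ, ξ ∈ M ↔ ∀ a, π.toHom j (π.toHom a ξ) = 0 := by
    intro ξ
    simp [M, Submodule.mem_iInf]
  have hclosed : IsClosed (M : Set π.H) := by
    have : (M : Set π.H) = ⋂ a, {ξ | π.toHom j (π.toHom a ξ) = 0} := by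
      ext ξ
      simp [hM]
    rw [this]
    exact isClosed_iInter fun a => isClosed_eq (by fun_prop) continuous_const
  have hinv : ∀ a, ∀ ξ ∈ M, π.toHom a ξ ∈ M := by
    intro a ξ hξ
    rw [hM] at hξ ⊢
    intro c
    have := hξ (c * a)
    rwa [map_mul] at this
  rcases π.irreducible M hclosed hinv with hbot | htop
  · refine hb (ContinuousLinearMap.ext fun ξ => ?_)
    have : π.toHom b ξ ∈ M := (hM _).2 fun a => by
      have := DFunLike.congr_fun (h a) ξ
      rwa [map_mul, map_mul] at this
    rw [hbot] at this
    simpa using this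
  · refine hj ((CStarRing.mul_star_self_eq_zero_iff _).1 ?_)
    rw [← map_star]
    ext ξ
    have : ξ ∈ M := by rw [htop]; trivial
    exact (hM ξ).1 this (star j)

/-- An element that does not vanish at `π` is a local section around `π` on the open set where it
does not vanish. -/
theorem IrrRep.fellRank_le_of_pedersenRank_le (π : IrrRep A) {b : A} {β : Ordinal.{u}}
    (hb : pedersenRank b ≤ β) (hπ : π.toHom b ≠ 0) : π.fellRank ≤ β := by
  let s : LocalSection A :=
    ⟨b, ⟨_, isOpen_setOf_notMem b⟩, fun ρ hρ h => hρ (IrrRep.mem_ker.2 h)⟩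
  refine (sInf_le ⟨s, fun h => hπ (IrrRep.mem_ker.1 h), rfl⟩ : π.fellRank ≤ s.fellRank).trans ?_
  exact weightRank_comp_le (w := pedersenFunction b) (f := fun t : s.U => (t : PrimitiveSpectrum A))
    continuous_subtype_val hb

/-- A local section around `π` can be replaced by an element that does not vanish at `π`: multiply
it from the left by an element of the ideal whose hull is the complement of the open set. -/
theorem IrrRep.exists_pedersenRank_le (π : IrrRep A) {β : Ordinal.{u}} (h : π.fellRank ≤ β) :
    ∃ a, pedersenRank a ≤ β ∧ π.toHom a ≠ 0 := by
  have hne : {r | ∃ s : LocalSection A, π.point ∈ s.U ∧ r = s.fellRank}.Nonempty := by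
    by_contra hne
    rw [Set.not_nonempty_iff_eq_empty] at hne
    rw [IrrRep.fellRank, hne, sInf_empty] at h
    exact absurd h (by simp)
  obtain ⟨s, hs, e⟩ := csInf_mem hne
  rw [IrrRep.fellRank, e] at h
  obtain ⟨J, hJ, hU⟩ := s.U.isOpen
  have hπJ : ¬ J ≤ π.ker := by
    have : π.point ∈ (s.U : Set (PrimitiveSpectrum A)) := hs
    rw [hU] at this
    exact this
  obtain ⟨j, hj, hj'⟩ := SetLike.not_le_iff_exists.1 hπJ
  rw [IrrRep.mem_ker] at hj'
  obtain ⟨x, hx⟩ := π.exists_mul_mul_ne_zero hj' (s.nonvanishing π hs)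
  refine ⟨j * x * s.b, ?_, hx⟩
  refine weightRank_le_of_isOpenEmbedding (f := fun t : s.U => (t : PrimitiveSpectrum A))
    s.U.isOpen.isOpenEmbedding_subtypeVal (fun t => pedersenFunction_mul_le _ _ _)
    (fun t ht => pedersenFunction_eq_zero ?_) h
  have htJ : t ∉ (s.U : Set (PrimitiveSpectrum A)) := fun h => ht ⟨⟨t, h⟩, rfl⟩
  rw [hU, Set.mem_compl_iff, not_not] at htJ
  exact htJ (J.mul_mem_right _ _ (J.mul_mem_right _ _ hj))

theorem fellIdeal_eq_top_iff (β : Ordinal.{u}) :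
    fellIdeal A β = ⊤ ↔ fellRank A ≤ (β : WithTop Ordinal.{u}) := by
  rw [fellRank, iSup_le_iff]
  constructor
  · intro h π
    by_contra hc
    have hle : fellIdeal A β ≤ π.ker := closedIdealSpan_le π.point.isClosed fun b hb => by
      by_contra hπ
      exact hc (π.fellRank_le_of_pedersenRank_le hb fun h0 => hπ (IrrRep.mem_ker.2 h0))
    obtain ⟨a, ha⟩ := π.ne_zero
    exact ha (IrrRep.mem_ker.1 (hle (by rw [h]; trivial)))
  · intro h
    by_contra hne
    obtain ⟨π, hπ⟩ := exists_irrRep_le_ker (isClosed_closedIdealSpan _) hne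
    obtain ⟨a, ha, ha'⟩ := π.exists_pedersenRank_le (h π)
    exact ha' (IrrRep.mem_ker.1 (hπ (subset_closedIdealSpan _ ha)))

end LocalSections

end

theorem mainTheorem4 {A : Type u} [NonUnitalCStarAlgebra A] [SeparableSpace A]
    (α : Ordinal.{u}) (hα : α < Ordinal.omega 1) :
    IsTypeI A α ↔ fellRank A ≤ ((1 + α : Ordinal.{u}) : WithTop Ordinal.{u}) :=
  fellIdeal_eq_top_iff (1 + α)
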